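/- For a real $n\times n$ matrix $A$ let $\|A\|_\infty=\max_{1\le i\le n}\sum_{j=1}^n|A_{ij}|$ denote the maximum absolute row sum, i.e. the operator norm induced by the $\ell^\infty$-norm on $\mathbb{R}^n$. Call $A$ \emph{diagonally dominant} if $|A_{ii}|-\sum_{j\neq i}|A_{ij}|\ge 0$ for all $i=1,\dots,n$. Let $n\ge 3$, and let $S=(n-2)I_n+\mathbf 1_n\mathbf 1_n^\top$, where $I_n$ is the $n\times n$ identity matrix and $\mathbf 1_n\in\mathbb{R}^n$ is the all-ones column vector. Let $\ell>0$, and let $J$ be a real symmetric, diagonally dominant $n\times n$ matrix with $J_{ij}\ge\ell$ for all $i,j$. Then $J$ and $S$ are invertible, and $$\|J^{-1}\|_\infty\le\frac1\ell\,\|S^{-1}\|_\infty=\frac{3n-4}{2\ell(n-2)(n-1)}.$$ Moreover, $\|J^{-1}\|_\infty=\frac1\ell\|S^{-1}\|_\infty$ if and only if $J=\ell S$. -/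

import Mathlib

open scoped Matrix.Norms.Operator

namespace InverseBound

/-- `Δ_i(J) = |J_ii| - ∑_{j ≠ i} |J_ij|`. -/
def dominance {n : ℕ} (J : Matrix (Fin n) (Fin n) ℝ) (i : Fin n) : ℝ :=
  |J i i| - ∑ j ∈ Finset.univ.erase i, |J i j|

/-- (Weak) diagonal dominance by rows. -/
def DiagonallyDominant {n : ℕ} (J : Matrix (Fin n) (Fin n) ℝ) : Prop :=
  ∀ i, 0 ≤ dominance J i

/-- The matrix `S = (n - 2) I + 𝟏 𝟏ᵀ`. -/
def S (n : ℕ) : Matrix (Fin n) (Fin n) ℝ :=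
  ((n : ℝ) - 2) • (1 : Matrix (Fin n) (Fin n) ℝ)
    + Matrix.vecMulVec (fun _ => (1 : ℝ)) (fun _ => (1 : ℝ))

/-- The matrix norm induced by the infinity norm on vectors, as Mathlib's `L∞` operator norm. -/
noncomputable def infNorm {n : ℕ} (A : Matrix (Fin n) (Fin n) ℝ) : ℝ :=
  ‖A‖

/-- `infNorm` is the maximum absolute row sum (and is `0` when there are no rows). -/
theorem infNorm_eq_iSup {n : ℕ} (A : Matrix (Fin n) (Fin n) ℝ) :
    infNorm A = ⨆ i, ∑ j, |A i j| := by
  unfold infNorm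
  rw [Matrix.linfty_opNorm_def]
  rcases isEmpty_or_nonempty (Fin n) with h | h
  · simp
  · rw [← Finset.sup'_eq_sup Finset.univ_nonempty, Finset.sup'_univ_eq_ciSup, NNReal.coe_iSup]
    simp

end InverseBound

/-!
After dividing by `ℓ`, assume that every entry of `J` is at least `1`, and write `J = S + P`.
Then `P` has nonnegative off-diagonal entries and is diagonally dominant. Put
`C = 2 (n - 2) (n - 1) / (3 n - 4)`, the reciprocal of the claimed value of the norm. The claim is
that `‖x‖_∞ = 1` forces `‖J x‖_∞ ≥ C`, with equality only for `J = S`. Replacing `x` by `-x`, let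
`x i = 1` be an entry of maximal absolute value, let `σ` be the sum of the entries of `x`, and
suppose that `‖J x‖_∞ ≤ β ≤ C`.

* Row `i` of `J x` is at least `n - 2 + σ`, by dominance (`le_mulVec_of_eq_one`). Hence
  `σ ≤ C - (n - 2) = -D` with `D = (n - 2)² / (3 n - 4)`.
* The form `xᵀ P x` is a sum of nonnegative multiples of `x i ^ 2` and `(x i + x j) ^ 2`
  (`dotProduct_mulVec_eq_sum_sq`); this is where symmetry enters. So
  `β ‖x‖₁ ≥ xᵀ J x ≥ xᵀ S x = (n - 2) ‖x‖₂² + σ²`.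
* The excess of `(n - 2) ‖x‖₂² + σ²` over `C ‖x‖₁` is an explicit sum of terms that are
  nonnegative as soon as `σ ≤ -D` (`sum_sq_add_sq_sum_eq`).

Together these give `β = C`, and all the nonnegative terms vanish. The last of them then force
`x j = -n / (3 n - 4)` for `j ≠ i`. For this `x` no `x i` and no `x i + x j` with `i ≠ j` is zero,
so `P = 0` (`eq_and_eq_S_of_abs_mulVec_le`). The norm bound follows by applying this to
`x = r⁻¹ J⁻¹ b`, where `r = ‖J⁻¹‖_∞` and `b` is the sign vector of a row of `J⁻¹` with maximal
absolute sum.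
-/

namespace InverseBound

open Matrix Finset

/-! ### The quadratic form of a symmetric matrix as a sum of squares -/

/-- The coefficient `2 P i i - ∑ j, P i j` of `x i ^ 2` is the dominance of row `i` when the
entries of that row are nonnegative. -/
theorem dotProduct_mulVec_eq_sum_sq {n : ℕ} {P : Matrix (Fin n) (Fin n) ℝ} (hP : P.IsSymm)
    (x : Fin n → ℝ) :
    x ⬝ᵥ P *ᵥ x = ∑ i, ((2 * P i i - ∑ j, P i j) * x i ^ 2
      + 1 / 2 * ∑ j ∈ univ.erase i, P i j * (x i + x j) ^ 2) := by
  have hswap : ∑ i, ∑ j, P i j * x j ^ 2 = ∑ i, ∑ j, P i j * x i ^ 2 := by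
    rw [sum_comm]
    exact sum_congr rfl fun i _ => sum_congr rfl fun j _ => by rw [hP.apply i j]
  have hform : x ⬝ᵥ P *ᵥ x = ∑ i, ∑ j, x i * (P i j * x j) := by
    simp only [dotProduct, mulVec, mul_sum]
  have hrow : ∀ i, (2 * P i i - ∑ j, P i j) * x i ^ 2
      + 1 / 2 * ∑ j ∈ univ.erase i, P i j * (x i + x j) ^ 2
      = ∑ j, x i * (P i j * x j) + 1 / 2 * ∑ j, P i j * x j ^ 2
        - 1 / 2 * ∑ j, P i j * x i ^ 2 := by
    intro i
    have h1 := add_sum_erase univ (fun j => P i j * (x i + x j) ^ 2) (mem_univ i)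
    have h2 : ∑ j, P i j * (x i + x j) ^ 2
        = ∑ j, P i j * x i ^ 2 + 2 * ∑ j, x i * (P i j * x j) + ∑ j, P i j * x j ^ 2 := by
      rw [mul_sum, ← sum_add_distrib, ← sum_add_distrib]
      exact sum_congr rfl fun j _ => by ring
    have h3 : ∑ j, P i j * x i ^ 2 = (∑ j, P i j) * x i ^ 2 := by rw [sum_mul]
    rw [h2] at h1
    linear_combination 1 / 2 * h1 + h3
  rw [sum_congr rfl fun i _ => hrow i, sum_sub_distrib, sum_add_distrib, ← mul_sum, ← mul_sum,
    hswap, hform]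
  ring

theorem dominance_eq_of_nonneg {n : ℕ} {J : Matrix (Fin n) (Fin n) ℝ} (hJ : ∀ i j, 0 ≤ J i j)
    (i : Fin n) : dominance J i = 2 * J i i - ∑ j, J i j := by
  simp only [dominance, abs_of_nonneg (hJ _ _)]
  linarith [add_sum_erase univ (fun j => J i j) (mem_univ i)]

theorem S_apply (n : ℕ) (i j : Fin n) : S n i j = (if i = j then (n : ℝ) - 2 else 0) + 1 := by
  simp [S, Matrix.one_apply, vecMulVec_apply]

theorem isSymm_S (n : ℕ) : (S n).IsSymm := by
  ext i j
  simp [S_apply, eq_comm]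

theorem one_le_S {n : ℕ} (hn : 3 ≤ n) (i j : Fin n) : 1 ≤ S n i j := by
  have : (3 : ℝ) ≤ n := by exact_mod_cast hn
  rw [S_apply]
  split_ifs <;> linarith

theorem S_mulVec {n : ℕ} (x : Fin n → ℝ) (i : Fin n) :
    (S n *ᵥ x) i = ((n : ℝ) - 2) * x i + ∑ j, x j := by
  simp [mulVec, dotProduct, S_apply, add_mul, sum_add_distrib]

theorem two_mul_S_sub_sum (n : ℕ) (i : Fin n) : 2 * S n i i - ∑ j, S n i j = 0 := by
  simp [S_apply, sum_add_distrib]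
  ring

theorem diagonallyDominant_S {n : ℕ} (hn : 3 ≤ n) : DiagonallyDominant (S n) := fun i => by
  rw [dominance_eq_of_nonneg fun i j => zero_le_one.trans (one_le_S hn i j), two_mul_S_sub_sum]

theorem dotProduct_S_mulVec {n : ℕ} (x : Fin n → ℝ) :
    x ⬝ᵥ S n *ᵥ x = ((n : ℝ) - 2) * ∑ j, x j ^ 2 + (∑ j, x j) ^ 2 := by
  simp only [dotProduct, S_mulVec]
  rw [sq (∑ j, x j), sum_mul, mul_sum, ← sum_add_distrib]
  exact sum_congr rfl fun j _ => by ring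

/-! ### The lower bound for `J x` -/

/-- The sharp constant: the reciprocal of the maximum absolute row sum of `(S n)⁻¹`. -/
noncomputable def sharpConst (n : ℕ) : ℝ :=
  2 * ((n : ℝ) - 2) * ((n : ℝ) - 1) / (3 * n - 4)

theorem sharpConst_pos {n : ℕ} (hn : 3 ≤ n) : 0 < sharpConst n := by
  have : (3 : ℝ) ≤ n := by exact_mod_cast hn
  have h1 : (0 : ℝ) < n - 2 := by linarith
  have h2 : (0 : ℝ) < n - 1 := by linarith
  have h3 : (0 : ℝ) < 3 * n - 4 := by linarith
  unfold sharpConst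
  positivity

theorem le_mulVec_of_eq_one {n : ℕ} {J : Matrix (Fin n) (Fin n) ℝ}
    (hdom : DiagonallyDominant J) (hJ : ∀ i j, 1 ≤ J i j) {x : Fin n → ℝ} {i : Fin n}
    (hi : x i = 1) (hx : ∀ j, |x j| ≤ 1) : (n : ℝ) - 2 + ∑ j, x j ≤ (J *ᵥ x) i := by
  have hd := hdom i
  rw [dominance_eq_of_nonneg fun i j => zero_le_one.trans (hJ i j)] at hd
  have h1 : ∑ j ∈ univ.erase i, (1 + x j) ≤ ∑ j ∈ univ.erase i, J i j * (1 + x j) :=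
    sum_le_sum fun j _ =>
      le_mul_of_one_le_left (by linarith [(abs_le.1 (hx j)).1]) (hJ i j)
  have h2 := add_sum_erase univ (fun j => 1 + x j) (mem_univ i)
  have h3 := add_sum_erase univ (fun j => J i j * (1 + x j)) (mem_univ i)
  simp only [mul_add, mul_one, sum_add_distrib, sum_const, card_univ, Fintype.card_fin,
    nsmul_eq_mul, hi] at h1 h2 h3
  simp only [mulVec, dotProduct]
  linarith

/-- The summands over `j ≠ i` on the right are nonnegative and vanish exactly at the entries
`x j = -n / (3 n - 4)` of the extremal vector; the last product is nonnegative once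
`∑ j, x j ≤ -(n - 2) ^ 2 / (3 n - 4)`. -/
theorem sum_sq_add_sq_sum_eq {n : ℕ} (hn : 3 ≤ n) {x : Fin n → ℝ} {i : Fin n} (hi : x i = 1) :
    ((n : ℝ) - 2) * ∑ j, x j ^ 2 + (∑ j, x j) ^ 2 = sharpConst n * ∑ j, |x j|
      + ∑ j ∈ univ.erase i, (((n : ℝ) - 2) * (|x j| - n / (3 * n - 4)) ^ 2
          + 2 * ((n : ℝ) - 2) / (3 * n - 4) * (|x j| + x j))
      + (-(∑ j, x j) - ((n : ℝ) - 2) ^ 2 / (3 * n - 4))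
        * (-(∑ j, x j) + (((n : ℝ) - 2) ^ 2 + 2 * (n - 2)) / (3 * n - 4)) := by
  have hn' : (3 : ℝ) ≤ n := by exact_mod_cast hn
  obtain ⟨d, hd⟩ : ∃ d : ℝ, 3 * (n : ℝ) - 4 = d := ⟨_, rfl⟩
  have h3 : d ≠ 0 := by linarith
  have hnd : (n : ℝ) = (d + 4) / 3 := by linarith
  unfold sharpConst
  rw [hd]
  have e : ∀ j, ((n : ℝ) - 2) * (|x j| - n / d) ^ 2
      + 2 * ((n : ℝ) - 2) / d * (|x j| + x j)
      = ((n : ℝ) - 2) * x j ^ 2 - 2 * ((n : ℝ) - 2) * ((n : ℝ) - 1) / d * |x j|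
        + 2 * ((n : ℝ) - 2) / d * x j
        + ((n : ℝ) - 2) * (n / d) ^ 2 := by
    intro j
    have := sq_abs (x j)
    rw [← this]
    rw [hnd]
    field_simp
    ring
  have hs := add_sum_erase univ (fun j => ((n : ℝ) - 2) * x j ^ 2 - 2 * ((n : ℝ) - 2) * ((n : ℝ) - 1) / d * |x j|
        + 2 * ((n : ℝ) - 2) / d * x j
        + ((n : ℝ) - 2) * (n / d) ^ 2) (mem_univ i)
  simp only [hi, abs_one, sum_add_distrib (s := univ), sum_sub_distrib (s := univ), ← mul_sum,
    sum_const (s := univ), card_univ, Fintype.card_fin, nsmul_eq_mul] at hs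
  rw [sum_congr rfl fun j _ => e j, eq_sub_of_add_eq' hs, hnd]
  field_simp
  ring

/-- If `‖x‖_∞ = 1` and `‖J x‖_∞ ≤ sharpConst n`, then equality holds and `J = S n`. The sup norm
of `x` is attained with a positive sign at the index `i`. -/
theorem eq_and_eq_S_of_abs_mulVec_le {n : ℕ} (hn : 3 ≤ n) {J : Matrix (Fin n) (Fin n) ℝ}
    (hsymm : J.IsSymm) (hdom : DiagonallyDominant J) (hJ : ∀ i j, 1 ≤ J i j)
    {x : Fin n → ℝ} {i : Fin n} (hi : x i = 1) (hx : ∀ j, |x j| ≤ 1) {β : ℝ}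
    (hβ : ∀ j, |(J *ᵥ x) j| ≤ β) (hβC : β ≤ sharpConst n) :
    β = sharpConst n ∧ J = S n := by
  have hn' : (3 : ℝ) ≤ n := by exact_mod_cast hn
  have h2 : (0 : ℝ) < n - 2 := by linarith
  have h3 : (0 : ℝ) < 3 * n - 4 := by linarith
  have hσ : ∑ j, x j ≤ -(((n : ℝ) - 2) ^ 2 / (3 * n - 4)) := by
    have h := le_mulVec_of_eq_one hdom hJ hi hx
    have hD : sharpConst n = (n : ℝ) - 2 - ((n : ℝ) - 2) ^ 2 / (3 * n - 4) := by
      unfold sharpConst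
      rw [eq_sub_iff_add_eq, ← add_div, div_eq_iff h3.ne']
      ring
    linarith [le_abs_self ((J *ᵥ x) i), hβ i]
  -- `P = J - S` has nonnegative off-diagonal entries and is diagonally dominant.
  have hPsymm : (J - S n).IsSymm := hsymm.sub (isSymm_S n)
  have hPoff : ∀ k j, j ≠ k → 0 ≤ (J - S n) k j := fun k j hjk => by
    have := hJ k j
    rw [Matrix.sub_apply, S_apply, if_neg hjk.symm]
    linarith
  have hPdom : ∀ k, 0 ≤ 2 * (J - S n) k k - ∑ j, (J - S n) k j := fun k => by
    have h1 := hdom k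
    rw [dominance_eq_of_nonneg fun i j => zero_le_one.trans (hJ i j)] at h1
    have h2 := two_mul_S_sub_sum n k
    simp only [Matrix.sub_apply, sum_sub_distrib]
    linarith
  have hPterm : ∀ k, 0 ≤ ∑ j ∈ univ.erase k, (J - S n) k j * (x k + x j) ^ 2 := fun k =>
    sum_nonneg fun j hj => mul_nonneg (hPoff k j (ne_of_mem_erase hj)) (sq_nonneg _)
  have hProw : ∀ k ∈ univ, 0 ≤ (2 * (J - S n) k k - ∑ j, (J - S n) k j) * x k ^ 2
      + 1 / 2 * ∑ j ∈ univ.erase k, (J - S n) k j * (x k + x j) ^ 2 := fun k _ =>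
    add_nonneg (mul_nonneg (hPdom k) (sq_nonneg _)) (mul_nonneg (by norm_num) (hPterm k))
  have hform := dotProduct_mulVec_eq_sum_sq hPsymm x
  have hE := sum_nonneg hProw
  have hS := sum_sq_add_sq_sum_eq hn hi
  have hκ : 0 < 2 * ((n : ℝ) - 2) / (3 * n - 4) := by positivity
  have hterm : ∀ j ∈ univ.erase i, 0 ≤ ((n : ℝ) - 2) * (|x j| - n / (3 * n - 4)) ^ 2
      + 2 * ((n : ℝ) - 2) / (3 * n - 4) * (|x j| + x j) := fun j _ =>
    add_nonneg (by positivity) (mul_nonneg hκ.le (by linarith [neg_abs_le (x j)]))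
  have hR := sum_nonneg hterm
  have hlast : 0 ≤ (-(∑ j, x j) - ((n : ℝ) - 2) ^ 2 / (3 * n - 4))
        * (-(∑ j, x j) + (((n : ℝ) - 2) ^ 2 + 2 * (n - 2)) / (3 * n - 4)) := by
    have h4 : 0 ≤ ((n : ℝ) - 2) ^ 2 / (3 * n - 4) := by positivity
    have h5 : 0 ≤ (((n : ℝ) - 2) ^ 2 + 2 * (n - 2)) / (3 * n - 4) := by positivity
    exact mul_nonneg (by linarith) (by linarith)
  have hupper : x ⬝ᵥ J *ᵥ x ≤ β * ∑ j, |x j| := by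
    rw [mul_sum]
    refine sum_le_sum fun j _ => (le_abs_self _).trans ?_
    rw [abs_mul, mul_comm]
    exact mul_le_mul_of_nonneg_right (hβ j) (abs_nonneg _)
  have hsplit : x ⬝ᵥ J *ᵥ x = x ⬝ᵥ (J - S n) *ᵥ x + x ⬝ᵥ S n *ᵥ x := by
    rw [← dotProduct_add, ← add_mulVec, sub_add_cancel]
  rw [hsplit, dotProduct_S_mulVec, hS, hform] at hupper
  have hnorm : 1 ≤ ∑ j, |x j| := by
    have := single_le_sum (f := fun j => |x j|) (fun j _ => abs_nonneg _) (mem_univ i)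
    simpa [hi] using this
  have hgap : (0 : ℝ) ≤ (sharpConst n - β) * (∑ j, |x j| - 1) :=
    mul_nonneg (by linarith) (by linarith)
  have hβeq : β = sharpConst n := by linarith
  subst hβeq
  refine ⟨rfl, ?_⟩
  -- Equality holds throughout, so `x` is the extremal vector and the form of `P` vanishes.
  have hR0 := (sum_eq_zero_iff_of_nonneg hterm).1 (by linarith)
  have hE0 := (sum_eq_zero_iff_of_nonneg hProw).1 (by linarith)
  have hxj : ∀ j, j ≠ i → x j = -(n / (3 * n - 4)) := fun j hj => by
    have h := hR0 j (mem_erase.2 ⟨hj, mem_univ j⟩)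
    have ha : 0 ≤ ((n : ℝ) - 2) * (|x j| - n / (3 * n - 4)) ^ 2 := by positivity
    have hb : 0 ≤ 2 * ((n : ℝ) - 2) / (3 * n - 4) * (|x j| + x j) :=
      mul_nonneg hκ.le (by linarith [neg_abs_le (x j)])
    have ha0 : ((n : ℝ) - 2) * (|x j| - n / (3 * n - 4)) ^ 2 = 0 := by linarith
    have hb0 : 2 * ((n : ℝ) - 2) / (3 * n - 4) * (|x j| + x j) = 0 := by linarith
    have ha1 := pow_eq_zero_iff two_ne_zero |>.1 ((mul_eq_zero.1 ha0).resolve_left h2.ne')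
    have hb1 := (mul_eq_zero.1 hb0).resolve_left hκ.ne'
    linarith
  have hb0 : (0 : ℝ) < n / (3 * n - 4) := by positivity
  have hb1 : (n : ℝ) / (3 * n - 4) < 1 := by
    rw [div_lt_one h3]
    linarith
  have hx0 : ∀ k, x k ≠ 0 := fun k => by
    by_cases hk : k = i
    · rw [hk, hi]; exact one_ne_zero
    · rw [hxj k hk]; linarith
  have hxx : ∀ k j, j ≠ k → x k + x j ≠ 0 := fun k j hjk => by
    by_cases hk : k = i
    · rw [hk, hi, hxj j (hk ▸ hjk)]; linarith
    · by_cases hj : j = i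
      · rw [hj, hi, hxj k hk]; linarith
      · rw [hxj k hk, hxj j hj]; linarith
  have hoff : ∀ k j, j ≠ k → (J - S n) k j = 0 := fun k j hjk => by
    have h := hE0 k (mem_univ k)
    have ha := mul_nonneg (hPdom k) (sq_nonneg (x k))
    have hs0 : ∑ j ∈ univ.erase k, (J - S n) k j * (x k + x j) ^ 2 = 0 := by
      linarith [hPterm k]
    have := (sum_eq_zero_iff_of_nonneg fun j hj =>
      mul_nonneg (hPoff k j (ne_of_mem_erase hj)) (sq_nonneg _)).1 hs0 j
        (mem_erase.2 ⟨hjk, mem_univ j⟩)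
    exact (mul_eq_zero.1 this).resolve_right (pow_ne_zero 2 (hxx k j hjk))
  have hdiag : ∀ k, (J - S n) k k = 0 := fun k => by
    have h := hE0 k (mem_univ k)
    have ha := mul_nonneg (hPdom k) (sq_nonneg (x k))
    have hd0 : (2 * (J - S n) k k - ∑ j, (J - S n) k j) * x k ^ 2 = 0 := by
      linarith [hPterm k]
    have hd1 := (mul_eq_zero.1 hd0).resolve_right (pow_ne_zero 2 (hx0 k))
    rw [sum_eq_single_of_mem k (mem_univ k) fun j _ hjk => hoff k j hjk] at hd1
    linarith
  rw [← sub_eq_zero]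
  ext k j
  by_cases hjk : j = k
  · rw [hjk, hdiag]; rfl
  · exact hoff k j hjk

/-! ### The norm of the inverse -/

theorem isUnit_of_one_le {n : ℕ} (hn : 3 ≤ n) {J : Matrix (Fin n) (Fin n) ℝ}
    (hsymm : J.IsSymm) (hdom : DiagonallyDominant J) (hJ : ∀ i j, 1 ≤ J i j) : IsUnit J := by
  rw [isUnit_iff_isUnit_det, isUnit_iff_ne_zero]
  intro hdet
  obtain ⟨v, hv, hJv⟩ := exists_mulVec_eq_zero_iff.2 hdet
  have : Nonempty (Fin n) := ⟨⟨0, by omega⟩⟩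
  obtain ⟨i, hi⟩ := Finite.exists_max fun j => |v j|
  have hvi : v i ≠ 0 := fun h => hv <| funext fun j => by
    have := hi j
    rw [h, abs_zero] at this
    exact abs_nonpos_iff.1 this
  have h := eq_and_eq_S_of_abs_mulVec_le hn hsymm hdom hJ (x := (v i)⁻¹ • v) (i := i)
    (by simp [hvi])
    (fun j => by
      rw [Pi.smul_apply, smul_eq_mul, abs_mul, abs_inv, inv_mul_le_one₀ (abs_pos.2 hvi)]
      exact hi j)
    (β := 0) (fun j => by simp [mulVec_smul, hJv]) (sharpConst_pos hn).le
  exact (sharpConst_pos hn).ne h.1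

theorem infNorm_inv_of_one_le {n : ℕ} (hn : 3 ≤ n) {J : Matrix (Fin n) (Fin n) ℝ}
    (hsymm : J.IsSymm) (hdom : DiagonallyDominant J) (hJ : ∀ i j, 1 ≤ J i j) :
    infNorm J⁻¹ ≤ (sharpConst n)⁻¹ ∧ (infNorm J⁻¹ = (sharpConst n)⁻¹ → J = S n) := by
  have hu := isUnit_of_one_le hn hsymm hdom hJ
  have hC := sharpConst_pos hn
  have hne : Nonempty (Fin n) := ⟨⟨0, by omega⟩⟩
  obtain ⟨i, hi⟩ := Finite.exists_max fun i => ∑ j, |J⁻¹ i j|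
  have hr : infNorm J⁻¹ = ∑ j, |J⁻¹ i j| := by
    rw [infNorm_eq_iSup]
    exact le_antisymm (ciSup_le hi) (le_ciSup (f := fun i => ∑ j, |J⁻¹ i j|)
      (Set.finite_range _).bddAbove i)
  have hr0 : 0 < infNorm J⁻¹ := by
    refine norm_pos_iff.2 fun h0 => ?_
    have h1 := mul_nonsing_inv J ((isUnit_iff_isUnit_det J).1 hu)
    rw [h0, mul_zero] at h1
    simpa using congrFun (congrFun h1 i) i
  set r := infNorm J⁻¹
  set b : Fin n → ℝ := fun j => SignType.sign (J⁻¹ i j) with hb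
  have hb1 : ∀ j, |b j| ≤ 1 := fun j => by
    simp only [hb]
    rcases lt_trichotomy (J⁻¹ i j) 0 with h | h | h <;> simp [h]
  have hJx : J *ᵥ (r⁻¹ • J⁻¹ *ᵥ b) = r⁻¹ • b := by
    rw [mulVec_smul, mulVec_mulVec, mul_nonsing_inv J ((isUnit_iff_isUnit_det J).1 hu),
      one_mulVec]
  have key : r⁻¹ ≤ sharpConst n → r⁻¹ = sharpConst n ∧ J = S n := by
    refine eq_and_eq_S_of_abs_mulVec_le hn hsymm hdom hJ (x := r⁻¹ • J⁻¹ *ᵥ b) (i := i)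
      ?_ (fun j => ?_) (fun j => ?_)
    · have : (J⁻¹ *ᵥ b) i = r := by
        rw [hr]
        simp only [mulVec, dotProduct, hb, self_mul_sign]
      rw [Pi.smul_apply, this, smul_eq_mul, inv_mul_cancel₀ hr0.ne']
    · rw [Pi.smul_apply, smul_eq_mul, abs_mul, abs_of_pos (inv_pos.2 hr0),
        inv_mul_le_one₀ hr0, hr]
      refine (abs_sum_le_sum_abs _ _).trans ((sum_le_sum fun k _ => ?_).trans (hi j))
      rw [abs_mul]
      exact mul_le_of_le_one_right (abs_nonneg _) (hb1 k)
    · rw [hJx, Pi.smul_apply, smul_eq_mul, abs_mul, abs_of_pos (inv_pos.2 hr0)]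
      exact mul_le_of_le_one_right (inv_pos.2 hr0).le (hb1 j)
  refine ⟨?_, fun h => (key (by rw [h, inv_inv])).2⟩
  rw [le_inv_comm₀ hr0 hC]
  rcases le_total r⁻¹ (sharpConst n) with h | h
  · exact (key h).1.ge
  · exact h

theorem inv_S {n : ℕ} (hn : 3 ≤ n) : (S n)⁻¹ = Matrix.of fun i j : Fin n =>
    ((n : ℝ) - 2)⁻¹ * ((if i = j then 1 else 0) - (2 * ((n : ℝ) - 1))⁻¹) := by
  have hn' : (3 : ℝ) ≤ n := by exact_mod_cast hn
  have h1 : (n : ℝ) - 1 ≠ 0 := by linarith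
  have h2 : (n : ℝ) - 2 ≠ 0 := by linarith
  refine inv_eq_right_inv ?_
  ext i j
  have h := S_mulVec (fun k => ((n : ℝ) - 2)⁻¹ *
    ((if k = j then 1 else 0) - (2 * ((n : ℝ) - 1))⁻¹)) i
  rw [← mul_sum, sum_sub_distrib] at h
  simp only [sum_ite_eq', mem_univ, if_true, sum_const, card_univ, Fintype.card_fin,
    nsmul_eq_mul] at h
  refine Eq.trans (b := (S n *ᵥ fun k => ((n : ℝ) - 2)⁻¹ *
    ((if k = j then 1 else 0) - (2 * ((n : ℝ) - 1))⁻¹)) i) rfl ?_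
  rw [h, Matrix.one_apply]
  split_ifs <;> field_simp <;> ring

theorem infNorm_inv_S {n : ℕ} (hn : 3 ≤ n) : infNorm (S n)⁻¹ = (sharpConst n)⁻¹ := by
  have hn' : (3 : ℝ) ≤ n := by exact_mod_cast hn
  have h1 : (0 : ℝ) < n - 1 := by linarith
  have h2 : (0 : ℝ) < n - 2 := by linarith
  have h3 : (0 : ℝ) < 3 * n - 4 := by linarith
  have hne : Nonempty (Fin n) := ⟨⟨0, by omega⟩⟩
  have hrow : ∀ i, ∑ j, |(S n)⁻¹ i j| = (sharpConst n)⁻¹ := by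
    intro i
    have hc : (2 * ((n : ℝ) - 1))⁻¹ ≤ 1 := inv_le_one_of_one_le₀ (by linarith)
    have hc0 : 0 < (2 * ((n : ℝ) - 1))⁻¹ := by positivity
    have e : ∀ j, |(S n)⁻¹ i j| = ((n : ℝ) - 2)⁻¹ *
        ((if i = j then 1 - 2 * (2 * ((n : ℝ) - 1))⁻¹ else 0) + (2 * ((n : ℝ) - 1))⁻¹) := by
      intro j
      rw [inv_S hn, of_apply, abs_mul, abs_of_pos (inv_pos.2 h2)]
      split_ifs
      · rw [abs_of_nonneg (by linarith)]; ring
      · rw [zero_sub, abs_neg, abs_of_pos hc0]; ring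
    rw [sum_congr rfl fun j _ => e j, ← mul_sum, sum_add_distrib, sum_ite_eq, if_pos (mem_univ i),
      sum_const, card_univ, Fintype.card_fin, nsmul_eq_mul, sharpConst]
    field_simp
    ring
  rw [infNorm_eq_iSup]
  simp only [hrow, ciSup_const]

end InverseBound

theorem mainTheorem1 (n : ℕ) (hn : 3 ≤ n) (J : Matrix (Fin n) (Fin n) ℝ) (ℓ : ℝ) (hℓ : 0 < ℓ)
    (hsymm : J.IsSymm) (hdom : InverseBound.DiagonallyDominant J) (hJ : ∀ i j, ℓ ≤ J i j) :
    IsUnit J ∧ IsUnit (InverseBound.S n) ∧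
    InverseBound.infNorm J⁻¹ ≤ 1 / ℓ * InverseBound.infNorm (InverseBound.S n)⁻¹ ∧
    1 / ℓ * InverseBound.infNorm (InverseBound.S n)⁻¹
      = (3 * (n : ℝ) - 4) / (2 * ℓ * ((n : ℝ) - 2) * ((n : ℝ) - 1)) ∧
    (InverseBound.infNorm J⁻¹ = 1 / ℓ * InverseBound.infNorm (InverseBound.S n)⁻¹
      ↔ J = ℓ • InverseBound.S n) := by
  open InverseBound in
  have hJpos : ∀ i j, 0 ≤ J i j := fun i j => hℓ.le.trans (hJ i j)
  -- The rescaled matrix `K = ℓ⁻¹ J` satisfies the hypotheses with `1` in place of `ℓ`.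
  obtain ⟨K, rfl⟩ : ∃ K, J = ℓ • K := ⟨ℓ⁻¹ • J, (smul_inv_smul₀ hℓ.ne' J).symm⟩
  have hK : ∀ i j, 1 ≤ K i j := fun i j => by
    have := hJ i j
    rw [Matrix.smul_apply, smul_eq_mul] at this
    exact (le_mul_iff_one_le_right hℓ).1 this
  have hKsymm : K.IsSymm := by
    ext i j
    have := hsymm.apply i j
    rw [Matrix.smul_apply, Matrix.smul_apply] at this
    exact smul_right_injective ℝ hℓ.ne' this
  have hKdom : DiagonallyDominant K := fun i => by
    have h := hdom i
    rw [dominance_eq_of_nonneg hJpos] at h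
    rw [dominance_eq_of_nonneg fun i j => zero_le_one.trans (hK i j)]
    simp only [Matrix.smul_apply, smul_eq_mul, ← Finset.mul_sum] at h
    refine (mul_nonneg_iff_of_pos_left hℓ).1 ?_
    linarith
  have hKu := isUnit_of_one_le hn hKsymm hKdom hK
  have hinv : infNorm (ℓ • K)⁻¹ = 1 / ℓ * infNorm K⁻¹ := by
    have : Invertible ℓ := invertibleOfNonzero hℓ.ne'
    rw [Matrix.inv_smul K ℓ ((Matrix.isUnit_iff_isUnit_det K).1 hKu), invOf_eq_inv, infNorm,
      norm_smul, Real.norm_of_nonneg (inv_pos.2 hℓ).le, one_div, infNorm]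
  obtain ⟨hle, heq⟩ := infNorm_inv_of_one_le hn hKsymm hKdom hK
  have hℓ' : 0 < 1 / ℓ := one_div_pos.2 hℓ
  refine ⟨?_, isUnit_of_one_le hn (isSymm_S n) (diagonallyDominant_S hn) (one_le_S hn), ?_, ?_,
    ?_⟩
  · exact (IsUnit.smul (Units.mk0 ℓ hℓ.ne') hKu :)
  · rw [hinv, infNorm_inv_S hn]
    exact mul_le_mul_of_nonneg_left hle hℓ'.le
  · rw [infNorm_inv_S hn, sharpConst, inv_div, div_mul_div_comm, one_mul]
    congr 1
    ring
  · rw [hinv, mul_right_inj' hℓ'.ne', infNorm_inv_S hn]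
    refine ⟨fun h => by rw [heq h], fun h => ?_⟩
    rw [smul_right_injective _ hℓ.ne' h, infNorm_inv_S hn]
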